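/- Let $K$ be a field, $n\ge 0$, $S=K[x_1,\ldots,x_n]$ with the standard grading, and let $I\subsetneq S$ be a proper homogeneous ideal such that $S/I$ is Artinian. For $k\in\mathbb Z$ let $h(k)=h_{S/I}(k)=\dim_K (S/I)_k$ be the Hilbert function of $S/I$, and let $k_0=\min\{k : h(k)\neq 0\}$. For integers $d,k$ put $$\beta^d_k(h)=\sum_{j=k_0}^{k}(-1)^{k-j}\binom{d-j}{k-j}h(j)\ \text{ if } k_0\le k\le d,\qquad \beta^d_k(h)=0\ \text{ otherwise},$$ and let $$\operatorname{qdepth}(h)=\max\{d\in\mathbb Z : \beta^d_k(h)\ge 0 \text{ for all } k\le d\}$$ be the Hilbert depth of $h$. Let $$\operatorname{reg}(S/I)=\max\{j-i : \beta_{i,j}(S/I)\neq 0\}$$ be the Castelnuovo–Mumford regularity of $S/I$, where $\beta_{i,j}(S/I)$ is the number of basis elements of degree $j$ in the $i$-th free module of a minimal graded free resolution of $S/I$ over $S$. Then $\operatorname{qdepth}(h)$ and $\operatorname{reg}(S/I)$ are well defined (the minimal graded free resolution exists, both maxima exist, and $\operatorname{reg}(S/I)$ does not depend on the chosen resolution),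 and $$\operatorname{qdepth}(h_{S/I})\le \operatorname{reg}(S/I).$$ -/

import Mathlib

open MvPolynomial

attribute [local instance] MvPolynomial.gradedAlgebra

/-! ### Hilbert depth of a numerical function -/

/-- The least integer at which `h` is nonzero (for `h` nonzero and vanishing far to the left). -/
noncomputable def initialDegree (h : ℤ → ℕ) : ℤ := sInf {j : ℤ | h j ≠ 0}

/-- `β^d_k(h) = ∑_{j = k₀}^{k} (-1)^(k-j) * binom(d-j, k-j) * h(j)` for `k₀ ≤ k ≤ d`, and `0`
otherwise.  In the sum `j ≤ k ≤ d`, so `k - j` and `d - j` are nonnegative and `Int.toNat`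
loses nothing. -/
noncomputable def hilbertBeta (h : ℤ → ℕ) (d k : ℤ) : ℤ :=
  if initialDegree h ≤ k ∧ k ≤ d then
    ∑ j ∈ Finset.Icc (initialDegree h) k,
      (-1 : ℤ) ^ (k - j).toNat * ((d - j).toNat.choose (k - j).toNat : ℤ) * (h j : ℤ)
  else 0

/-- `q` is the Hilbert depth of `h`: the maximum of all integers `d` such that
`β^d_k(h) ≥ 0` for all `k ≤ d`. -/
def IsHilbertDepth (h : ℤ → ℕ) (q : ℤ) : Prop :=
  IsGreatest {d : ℤ | ∀ k : ℤ, k ≤ d → 0 ≤ hilbertBeta h d k} q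

/-! ### Graded modules over the polynomial ring -/

/-- The component of degree `k : ℤ` of `K[x_1, …, x_n]`; it is zero for `k < 0`. -/
noncomputable def polyPart (K : Type*) [Field K] (n : ℕ) (k : ℤ) :
    Submodule K (MvPolynomial (Fin n) K) :=
  if 0 ≤ k then homogeneousSubmodule (Fin n) K k.toNat else ⊥

/-- The component of degree `k : ℤ` of `S ⧸ I`, where `S = K[x_1, …, x_n]`: the image of the
component of degree `k` of `S`. -/
noncomputable def quotientPart {K : Type*} [Field K] {n : ℕ} (I : Ideal (MvPolynomial (Fin n) K))
    (k : ℤ) : Submodule K (MvPolynomial (Fin n) K ⧸ I) :=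
  (polyPart K n k).map (Ideal.Quotient.mkₐ K I).toLinearMap

/-- The Hilbert function `k ↦ dim_K M_k` of a module with components `M_k = 𝓜 k`. -/
noncomputable def hilbertFunction {K M : Type*} [Field K] [AddCommGroup M] [Module K M]
    (𝓜 : ℤ → Submodule K M) (k : ℤ) : ℕ :=
  Module.finrank K (𝓜 k)

/-- A minimal graded free resolution `⋯ → F_2 → F_1 → F_0 → M → 0` of the graded module
`M = ⨁ 𝓜 k` over `S = K[x_1, …, x_n]`, where `F_i = ⨁_a S(-shift i a)` is a graded free module of
finite rank with standard basis elements `e_a` of degree `shift i a`. -/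
structure MinimalGradedFreeResolution {K : Type*} [Field K] {n : ℕ} {M : Type*} [AddCommGroup M]
    [Module K M] [Module (MvPolynomial (Fin n) K) M] (𝓜 : ℤ → Submodule K M) where
  /-- the rank of `F_i` -/
  rank : ℕ → ℕ
  /-- the degrees of the basis elements of `F_i` -/
  shift : (i : ℕ) → Fin (rank i) → ℤ
  /-- the differential `F_{i+1} → F_i` -/
  diff : (i : ℕ) → (Fin (rank (i + 1)) → MvPolynomial (Fin n) K) →ₗ[MvPolynomial (Fin n) K]
    (Fin (rank i) → MvPolynomial (Fin n) K)
  /-- the augmentation `F_0 → M` -/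
  aug : (Fin (rank 0) → MvPolynomial (Fin n) K) →ₗ[MvPolynomial (Fin n) K] M
  /-- the differentials are homogeneous of degree `0` -/
  diff_graded : ∀ (i : ℕ) (a : Fin (rank (i + 1))) (c : Fin (rank i)),
    diff i (Pi.single a 1) c ∈ polyPart K n (shift (i + 1) a - shift i c)
  /-- the augmentation is homogeneous of degree `0` -/
  aug_graded : ∀ a : Fin (rank 0), aug (Pi.single a 1) ∈ 𝓜 (shift 0 a)
  aug_surjective : Function.Surjective aug
  exact_zero : Function.Exact (diff 0) aug
  exact_succ : ∀ i : ℕ, Function.Exact (diff (i + 1)) (diff i)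
  /-- minimality: the image of `F_{i+1}` lies in `(x_1, …, x_n) F_i` -/
  minimal : ∀ (i : ℕ) (v : Fin (rank (i + 1)) → MvPolynomial (Fin n) K) (c : Fin (rank i)),
    diff i v c ∈ Ideal.span (Set.range (X : Fin n → MvPolynomial (Fin n) K))

/-- The graded Betti number `β_{i,j}`: the number of basis elements of degree `j` in `F_i`. -/
def MinimalGradedFreeResolution.betti {K : Type*} [Field K] {n : ℕ} {M : Type*} [AddCommGroup M]
    [Module K M] [Module (MvPolynomial (Fin n) K) M] {𝓜 : ℤ → Submodule K M}
    (F : MinimalGradedFreeResolution (n := n) 𝓜) (i : ℕ) (j : ℤ) : ℕ :=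
  (Finset.univ.filter fun a : Fin (F.rank i) => F.shift i a = j).card

/-- `r` is the Castelnuovo-Mumford regularity of the graded module `M = ⨁ 𝓜 k` over
`K[x_1, …, x_n]`: the module has a minimal graded free resolution, and
`r = max {j - i : β_{i,j} ≠ 0}`, whichever minimal graded free resolution is used. -/
def IsRegularity {K : Type*} [Field K] (n : ℕ) {M : Type*} [AddCommGroup M]
    [Module K M] [Module (MvPolynomial (Fin n) K) M] (𝓜 : ℤ → Submodule K M) (r : ℤ) : Prop :=
  Nonempty (MinimalGradedFreeResolution (n := n) 𝓜) ∧
    ∀ F : MinimalGradedFreeResolution (n := n) 𝓜,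
      IsGreatest {s : ℤ | ∃ (i : ℕ) (j : ℤ), F.betti i j ≠ 0 ∧ s = j - i} r

/-! Both invariants are compared with the top degree s of M = S/I, which exists because S/I is
Artinian.

Hilbert depth: summing β^d_k over k gives h(d), since alternating sums of binomials cancel
(`sum_hilbertBeta`). If d > s were admissible, nonnegative numbers would sum to h(d) = 0, although
β^d_{k₀} = h(k₀) > 0. Hence qdepth ≤ s (`exists_isHilbertDepth_le`).

Regularity: reg M = s. Put J_m = (x_0, …, x_{m-1}) and T_i^m = Tor_i(M, S/J_m), the homology of
F/J_m F. The sequence 0 → S/J_m(-1) → S/J_m → S/J_{m+1} → 0, given by multiplication by x_m, induces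
a long exact sequence, unwound here on elements. Induction on m shows that T_i^m vanishes in degrees
above i + s (`exists_eq_diff_add`) and that T_m^m is nonzero in degree m + s (`exists_ne_diff_add`).
For m = n minimality kills the differential modulo J_n, so T_i^n has the basis of F_i: all shifts
are at most i + s, with equality for some basis element of F_n. -/

/-! ### Homogeneous components in integer degrees -/

section Components

variable {K : Type*} [Field K] {n : ℕ}

/-- The homogeneous component of degree `k : ℤ` of a polynomial. -/
noncomputable def intComponent (K : Type*) [Field K] (n : ℕ) (k : ℤ) :
    MvPolynomial (Fin n) K →ₗ[K] MvPolynomial (Fin n) K :=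
  if 0 ≤ k then homogeneousComponent k.toNat else 0

lemma coeff_intComponent (k : ℤ) (f : MvPolynomial (Fin n) K) (d : Fin n →₀ ℕ) :
    coeff d (intComponent K n k f) = if (d.degree : ℤ) = k then coeff d f else 0 := by
  unfold intComponent
  split_ifs with h0 h1 h1
  · rw [coeff_homogeneousComponent, if_pos (by omega)]
  · rw [coeff_homogeneousComponent, if_neg (by omega)]
  · omega
  · simp

lemma degree_eq_weight_one_apply (d : Fin n →₀ ℕ) : d.degree = Finsupp.weight 1 d := by
  rw [Finsupp.degree_eq_weight_one]
  rfl

lemma mem_polyPart_iff {k : ℤ} {f : MvPolynomial (Fin n) K} :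
    f ∈ polyPart K n k ↔ ∀ d, coeff d f ≠ 0 → (d.degree : ℤ) = k := by
  unfold polyPart
  split_ifs with h0
  · rw [mem_homogeneousSubmodule]
    constructor
    · intro h d hd
      have := h hd
      rw [← degree_eq_weight_one_apply] at this
      omega
    · intro h d hd
      have := h d hd
      rw [← degree_eq_weight_one_apply]
      omega
  · rw [Submodule.mem_bot]
    constructor
    · rintro rfl d hd
      simp at hd
    · intro h
      ext d
      by_contra hd
      have := h d (by simpa using hd)
      omega

lemma intComponent_mem (k : ℤ) (f : MvPolynomial (Fin n) K) :
    intComponent K n k f ∈ polyPart K n k := by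
  rw [mem_polyPart_iff]
  intro d hd
  rw [coeff_intComponent] at hd
  by_contra h
  exact hd (if_neg h)

lemma intComponent_of_mem {k : ℤ} {f : MvPolynomial (Fin n) K} (hf : f ∈ polyPart K n k) :
    intComponent K n k f = f := by
  ext d
  rw [coeff_intComponent]
  split_ifs with h
  · rfl
  · by_contra h'
    exact h (mem_polyPart_iff.1 hf d (Ne.symm h'))

/-- All compatibilities with the grading below come from this identity: multiplication by a
variable, graded maps and the augmentation. -/
lemma intComponent_mul {l : ℤ} {p : MvPolynomial (Fin n) K} (hp : p ∈ polyPart K n l) (k : ℤ)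
    (f : MvPolynomial (Fin n) K) :
    intComponent K n k (f * p) = intComponent K n (k - l) f * p := by
  ext d
  rw [coeff_intComponent, coeff_mul, coeff_mul]
  have key : ∀ x ∈ Finset.HasAntidiagonal.antidiagonal d, coeff x.2 p ≠ 0 →
      (d.degree : ℤ) = x.1.degree + l := by
    intro x hx hp'
    rw [← Finset.HasAntidiagonal.mem_antidiagonal.1 hx, map_add, Nat.cast_add, mem_polyPart_iff.1 hp _ hp']
  split_ifs with h
  · refine Finset.sum_congr rfl fun x hx => ?_
    by_cases hp' : coeff x.2 p = 0
    · simp [hp']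
    · rw [coeff_intComponent, if_pos]
      linarith [key x hx hp']
  · refine (Finset.sum_eq_zero fun x hx => ?_).symm
    by_cases hp' : coeff x.2 p = 0
    · simp [hp']
    · rw [coeff_intComponent, if_neg, zero_mul]
      intro h'
      exact h (by linarith [key x hx hp'])

lemma mul_mem_polyPart {k l : ℤ} {f g : MvPolynomial (Fin n) K}
    (hf : f ∈ polyPart K n k) (hg : g ∈ polyPart K n l) : f * g ∈ polyPart K n (k + l) := by
  have := intComponent_mul hg (k + l) f
  rw [add_sub_cancel_right, intComponent_of_mem hf] at this
  rw [← this]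
  exact intComponent_mem _ _

lemma X_mem_polyPart (i : Fin n) : (X i : MvPolynomial (Fin n) K) ∈ polyPart K n 1 := by
  rw [polyPart, if_pos zero_le_one, mem_homogeneousSubmodule]
  exact isHomogeneous_X K i

lemma one_mem_polyPart : (1 : MvPolynomial (Fin n) K) ∈ polyPart K n 0 := by
  rw [polyPart, if_pos le_rfl, mem_homogeneousSubmodule]
  exact isHomogeneous_one _ _

/-- Homogeneous ideals are stable under taking homogeneous components. -/
lemma intComponent_mem_of_isHomogeneous {I : Ideal (MvPolynomial (Fin n) K)}
    (hI : I.IsHomogeneous (homogeneousSubmodule (Fin n) K)) (k : ℤ) {f : MvPolynomial (Fin n) K}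
    (hf : f ∈ I) : intComponent K n k f ∈ I := by
  unfold intComponent
  split_ifs
  · exact homogeneousComponent_mem_of_mem hI hf _
  · simp

/-! ### Ideals generated by initial segments of the variables -/

/-- The ideal `(x_0, …, x_{m-1})`. -/
noncomputable def initialVarIdeal (K : Type*) [Field K] (n m : ℕ) :
    Ideal (MvPolynomial (Fin n) K) :=
  Ideal.span (X '' {i : Fin n | i.val < m})

lemma mem_initialVarIdeal {m : ℕ} {f : MvPolynomial (Fin n) K} :
    f ∈ initialVarIdeal K n m ↔ ∀ d, coeff d f ≠ 0 → ∃ i : Fin n, i.val < m ∧ d i ≠ 0 := by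
  rw [initialVarIdeal, mem_ideal_span_X_image]
  simp [mem_support_iff]

lemma initialVarIdeal_zero : initialVarIdeal K n 0 = ⊥ := by
  simp [initialVarIdeal]

lemma initialVarIdeal_self : initialVarIdeal K n n =
    Ideal.span (Set.range (X : Fin n → MvPolynomial (Fin n) K)) := by
  simp [initialVarIdeal]

lemma initialVarIdeal_le_succ (m : ℕ) : initialVarIdeal K n m ≤ initialVarIdeal K n (m + 1) :=
  Ideal.span_mono (Set.image_mono fun _ hi => Nat.lt_succ_of_lt hi)

lemma X_mem_initialVarIdeal {m : ℕ} {i : Fin n} (h : i.val < m) :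
    (X i : MvPolynomial (Fin n) K) ∈ initialVarIdeal K n m :=
  Ideal.subset_span ⟨i, h, rfl⟩

lemma intComponent_mem_initialVarIdeal {m : ℕ} (k : ℤ) {f : MvPolynomial (Fin n) K}
    (hf : f ∈ initialVarIdeal K n m) : intComponent K n k f ∈ initialVarIdeal K n m := by
  rw [mem_initialVarIdeal] at hf ⊢
  intro d hd
  rw [coeff_intComponent] at hd
  exact hf d fun h => hd (by simp [h])

lemma exists_of_mem_initialVarIdeal_succ {m : ℕ} (hm : m < n) {f : MvPolynomial (Fin n) K}
    (hf : f ∈ initialVarIdeal K n (m + 1)) :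
    ∃ u ∈ initialVarIdeal K n m, ∃ w, f = u + X ⟨m, hm⟩ * w := by
  have hset : {i : Fin n | i.val < m + 1} = insert ⟨m, hm⟩ {i : Fin n | i.val < m} := by
    ext i
    simp [Fin.ext_iff]
    omega
  rw [initialVarIdeal, hset, Set.image_insert_eq, Ideal.mem_span_insert] at hf
  obtain ⟨a, z, hz, rfl⟩ := hf
  exact ⟨z, hz, a, by ring⟩

/-- `x_m` is a nonzerodivisor modulo `(x_0, …, x_{m-1})`. -/
lemma mem_initialVarIdeal_of_X_mul_mem {m : ℕ} (hm : m < n) {f : MvPolynomial (Fin n) K}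
    (hf : X ⟨m, hm⟩ * f ∈ initialVarIdeal K n m) : f ∈ initialVarIdeal K n m := by
  rw [mem_initialVarIdeal] at hf ⊢
  intro d hd
  -- Multiplication by `x_m` only raises the exponent of `x_m`, so a variable of index below `m`
  -- dividing the new monomial already divides the old one.
  obtain ⟨i, hi, h⟩ := hf (Finsupp.single ⟨m, hm⟩ 1 + d) (by rwa [coeff_X_mul])
  refine ⟨i, hi, ?_⟩
  rwa [Finsupp.add_apply, Finsupp.single_eq_of_ne (by rintro rfl; simp at hi), zero_add] at h

lemma mem_initialVarIdeal_self_iff {f : MvPolynomial (Fin n) K} :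
    f ∈ initialVarIdeal K n n ↔ coeff 0 f = 0 := by
  rw [mem_initialVarIdeal]
  constructor
  · intro h
    by_contra h0
    obtain ⟨i, -, hi⟩ := h 0 h0
    simp at hi
  · intro h d hd
    have : d ≠ 0 := by rintro rfl; exact hd h
    obtain ⟨i, hi⟩ := Finsupp.ne_iff.1 this
    exact ⟨i, i.2, by simpa using hi⟩

/-! ### Homogeneous elements of graded free modules -/

/-- Homogeneity of degree `j` in `⨁_c S(-σ c)`. -/
def IsHomogeneousVec {r : ℕ} (σ : Fin r → ℤ) (j : ℤ) (v : Fin r → MvPolynomial (Fin n) K) : Prop :=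
  ∀ c, v c ∈ polyPart K n (j - σ c)

/-- The homogeneous component of degree `j` in `⨁_c S(-σ c)`. -/
noncomputable def vecComponent {r : ℕ} (σ : Fin r → ℤ) (j : ℤ) :
    (Fin r → MvPolynomial (Fin n) K) →ₗ[K] (Fin r → MvPolynomial (Fin n) K) :=
  LinearMap.pi fun c => (intComponent K n (j - σ c)).comp (LinearMap.proj c)

@[simp] lemma vecComponent_apply {r : ℕ} (σ : Fin r → ℤ) (j : ℤ)
    (v : Fin r → MvPolynomial (Fin n) K) (c : Fin r) :
    vecComponent σ j v c = intComponent K n (j - σ c) (v c) := rfl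

lemma isHomogeneousVec_vecComponent {r : ℕ} (σ : Fin r → ℤ) (j : ℤ)
    (v : Fin r → MvPolynomial (Fin n) K) : IsHomogeneousVec σ j (vecComponent σ j v) :=
  fun _ => intComponent_mem _ _

lemma IsHomogeneousVec.vecComponent_eq {r : ℕ} {σ : Fin r → ℤ} {j : ℤ}
    {v : Fin r → MvPolynomial (Fin n) K} (h : IsHomogeneousVec σ j v) : vecComponent σ j v = v :=
  funext fun c => intComponent_of_mem (h c)

lemma isHomogeneousVec_single {r : ℕ} (σ : Fin r → ℤ) (a : Fin r) :
    IsHomogeneousVec σ (σ a) (Pi.single a (1 : MvPolynomial (Fin n) K)) := by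
  intro c
  by_cases h : c = a
  · subst h
    simpa using one_mem_polyPart
  · simp [h]

lemma vecComponent_X_smul {r : ℕ} (σ : Fin r → ℤ) (j : ℤ) (i : Fin n)
    (v : Fin r → MvPolynomial (Fin n) K) :
    vecComponent σ j ((X i : MvPolynomial (Fin n) K) • v) =
      (X i : MvPolynomial (Fin n) K) • vecComponent σ (j - 1) v := by
  ext1 c
  simp only [vecComponent_apply, Pi.smul_apply, smul_eq_mul]
  rw [mul_comm, intComponent_mul (X_mem_polyPart i), mul_comm, sub_right_comm]

lemma IsHomogeneousVec.X_smul {r : ℕ} {σ : Fin r → ℤ} {j : ℤ} (i : Fin n)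
    {v : Fin r → MvPolynomial (Fin n) K} (h : IsHomogeneousVec σ j v) :
    IsHomogeneousVec σ (j + 1) ((X i : MvPolynomial (Fin n) K) • v) := by
  have := vecComponent_X_smul σ (j + 1) i v
  rw [add_sub_cancel_right, h.vecComponent_eq] at this
  rw [← this]
  exact isHomogeneousVec_vecComponent _ _ _

lemma linearMap_pi_apply_eq_sum {R M ι : Type*} [CommSemiring R] [AddCommMonoid M] [Module R M]
    [Fintype ι] [DecidableEq ι] (f : (ι → R) →ₗ[R] M) (x : ι → R) :
    f x = ∑ i, x i • f (Pi.single i 1) := by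
  rw [f.pi_apply_eq_sum_univ]
  refine Finset.sum_congr rfl fun i _ => ?_
  congr 2
  ext j
  simp [Pi.single_apply, eq_comm]

lemma linearMap_apply_eq_sum {r r' : ℕ} (φ : (Fin r' → MvPolynomial (Fin n) K)
      →ₗ[MvPolynomial (Fin n) K] (Fin r → MvPolynomial (Fin n) K))
    (v : Fin r' → MvPolynomial (Fin n) K) (c : Fin r) :
    φ v c = ∑ a, v a * φ (Pi.single a 1) c := by
  rw [linearMap_pi_apply_eq_sum]
  simp [Finset.sum_apply]

/-- Homogeneity on basis vectors suffices. Consequently kernels are graded and homogeneous images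
have homogeneous preimages. -/
lemma map_vecComponent {r r' : ℕ} {σ : Fin r → ℤ} {σ' : Fin r' → ℤ}
    {φ : (Fin r' → MvPolynomial (Fin n) K)
      →ₗ[MvPolynomial (Fin n) K] (Fin r → MvPolynomial (Fin n) K)}
    (hφ : ∀ a c, φ (Pi.single a 1) c ∈ polyPart K n (σ' a - σ c)) (j : ℤ)
    (v : Fin r' → MvPolynomial (Fin n) K) :
    φ (vecComponent σ' j v) = vecComponent σ j (φ v) := by
  ext1 c
  rw [vecComponent_apply, linearMap_apply_eq_sum, linearMap_apply_eq_sum, map_sum]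
  refine Finset.sum_congr rfl fun a _ => ?_
  rw [intComponent_mul (hφ a c), vecComponent_apply]
  congr 3
  ring

lemma map_mem_ideal {r r' : ℕ} (φ : (Fin r' → MvPolynomial (Fin n) K)
      →ₗ[MvPolynomial (Fin n) K] (Fin r → MvPolynomial (Fin n) K))
    {J : Ideal (MvPolynomial (Fin n) K)} {v : Fin r' → MvPolynomial (Fin n) K}
    (hv : ∀ a, v a ∈ J) (c : Fin r) : φ v c ∈ J := by
  rw [linearMap_apply_eq_sum]
  exact J.sum_mem fun a _ => J.mul_mem_right _ (hv a)

end Components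

/-! ### Degrees in a minimal graded free resolution of a module of finite length -/

namespace MinimalGradedFreeResolution

variable {K : Type*} [Field K] {n : ℕ} {M : Type*} [AddCommGroup M] [Module K M]
  [Module (MvPolynomial (Fin n) K) M] {𝓜 : ℤ → Submodule K M}
  (F : MinimalGradedFreeResolution (n := n) 𝓜)

lemma diff_vecComponent (i : ℕ) (j : ℤ) (v : Fin (F.rank (i + 1)) → MvPolynomial (Fin n) K) :
    F.diff i (vecComponent (F.shift (i + 1)) j v) = vecComponent (F.shift i) j (F.diff i v) :=
  map_vecComponent (F.diff_graded i) j v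

lemma diff_diff (i : ℕ) (v : Fin (F.rank (i + 2)) → MvPolynomial (Fin n) K) :
    F.diff i (F.diff (i + 1) v) = 0 :=
  (F.exact_succ i _).2 ⟨v, rfl⟩

/-- `z ∈ F_i` is a cycle modulo `J F_{i-1}`; there is no condition for `i = 0`. -/
def IsCycleMod (J : Ideal (MvPolynomial (Fin n) K)) :
    (i : ℕ) → (Fin (F.rank i) → MvPolynomial (Fin n) K) → Prop
  | 0, _ => True
  | i + 1, z => ∀ c, F.diff i z c ∈ J

/-- Vanishing of `Tor_i(M, S/(x_0, …, x_{m-1}))` for `i > m`, and in degrees greater than `i + s`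
if `M` vanishes in degrees greater than `s`. -/
theorem exists_eq_diff_add {s : ℤ}
    (hs : ∀ j, s < j → ∀ z, IsHomogeneousVec (F.shift 0) j z → F.aug z = 0) (m : ℕ) :
    m ≤ n → ∀ (i : ℕ) (j : ℤ) (z : Fin (F.rank i) → MvPolynomial (Fin n) K),
      IsHomogeneousVec (F.shift i) j z → F.IsCycleMod (initialVarIdeal K n m) i z →
      m < i ∨ i + s < j →
      ∃ v w, IsHomogeneousVec (F.shift (i + 1)) j v ∧ (∀ c, w c ∈ initialVarIdeal K n m) ∧
        z = F.diff i v + w := by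
  induction m with
  | zero =>
    intro _ i j z hz hc hij
    have hrange : ∃ v, F.diff i v = z := by
      cases i with
      | zero =>
        refine (F.exact_zero z).1 (hs j ?_ z hz)
        simpa using hij
      | succ i =>
        refine (F.exact_succ i z).1 (funext fun c => ?_)
        simpa [initialVarIdeal_zero] using hc c
    obtain ⟨v, hv⟩ := hrange
    refine ⟨vecComponent (F.shift (i + 1)) j v, 0, isHomogeneousVec_vecComponent _ _ _,
      fun c => Ideal.zero_mem _, ?_⟩
    rw [F.diff_vecComponent, hv, hz.vecComponent_eq, add_zero]
  | succ m ih =>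
    intro hm i j z hz hc hij
    have hm' : m < n := hm
    cases i with
    | zero =>
      -- Tor_0 modulo the larger ideal is a quotient of Tor_0 modulo the smaller one.
      obtain ⟨v, w, hv, hw, h⟩ := ih hm'.le 0 j z hz trivial (Or.inr (by simpa using hij))
      exact ⟨v, w, hv, fun c => initialVarIdeal_le_succ m (hw c), h⟩
    | succ i =>
      -- Connecting homomorphism: writing `F.diff i z` as `u + x_m w` sends the class of `z` to that
      -- of `w`, one homological and one internal degree lower. Taking components makes both terms
      -- homogeneous.
      choose u hu w₀ hw₀ using fun c => exists_of_mem_initialVarIdeal_succ hm' (hc c)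
      have hz₀ : F.diff i z = u + (X ⟨m, hm'⟩ : MvPolynomial (Fin n) K) • w₀ := funext hw₀
      set u' := vecComponent (F.shift i) j u with hu'
      set w := vecComponent (F.shift i) (j - 1) w₀ with hw
      have hdz : F.diff i z = u' + (X ⟨m, hm'⟩ : MvPolynomial (Fin n) K) • w := by
        rw [hw, ← vecComponent_X_smul, hu', ← map_add, ← hz₀, ← F.diff_vecComponent,
          hz.vecComponent_eq]
      have hu'J : ∀ c, u' c ∈ initialVarIdeal K n m := fun c =>
        intComponent_mem_initialVarIdeal _ (hu c)
      have hwc : F.IsCycleMod (initialVarIdeal K n m) i w := by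
        cases i with
        | zero => trivial
        | succ i =>
          intro c
          have h0 := F.diff_diff i z
          rw [hdz, map_add, map_smul] at h0
          have h1 := congrFun h0 c
          simp only [Pi.add_apply, Pi.smul_apply, smul_eq_mul, Pi.zero_apply] at h1
          apply mem_initialVarIdeal_of_X_mul_mem hm'
          rw [eq_neg_of_add_eq_zero_right h1]
          exact neg_mem (map_mem_ideal _ hu'J c)
      -- The class of `w` vanishes by induction. Correcting `z` by `x_m v` then gives a cycle modulo
      -- the smaller ideal, to which induction applies again; the correction itself lies in the
      -- larger ideal.
      obtain ⟨v, w', hv, hw', hvw⟩ := ih hm'.le i (j - 1) w (isHomogeneousVec_vecComponent _ _ _) hwc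
        (by push_cast at hij; omega)
      have hXv : IsHomogeneousVec (F.shift (i + 1)) j
          ((X ⟨m, hm'⟩ : MvPolynomial (Fin n) K) • v) := by
        simpa using hv.X_smul ⟨m, hm'⟩
      obtain ⟨v₂, w₂, hv₂, hw₂, h₂⟩ := ih hm'.le (i + 1) j
        (z - (X ⟨m, hm'⟩ : MvPolynomial (Fin n) K) • v) (fun c => sub_mem (hz c) (hXv c))
        (by
          intro c
          rw [map_sub, map_smul, hdz, hvw]
          have : (u' + (X ⟨m, hm'⟩ : MvPolynomial (Fin n) K) • (F.diff i v + w') -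
              (X ⟨m, hm'⟩ : MvPolynomial (Fin n) K) • F.diff i v) c =
              u' c + X ⟨m, hm'⟩ * w' c := by
            simp only [Pi.add_apply, Pi.sub_apply, Pi.smul_apply, smul_eq_mul]
            ring
          rw [this]
          exact add_mem (hu'J c) (Ideal.mul_mem_left _ _ (hw' c)))
        (by push_cast at hij ⊢; omega)
      refine ⟨v₂, w₂ + (X ⟨m, hm'⟩ : MvPolynomial (Fin n) K) • v, hv₂, fun c => ?_, ?_⟩
      · exact add_mem (initialVarIdeal_le_succ m (hw₂ c))
          (Ideal.mul_mem_right _ _ (X_mem_initialVarIdeal (Nat.lt_succ_self m)))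
      · rw [← add_assoc, ← h₂, sub_add_cancel]

lemma diff_mem_initialVarIdeal (i : ℕ) (v : Fin (F.rank (i + 1)) → MvPolynomial (Fin n) K)
    (c : Fin (F.rank i)) : F.diff i v c ∈ initialVarIdeal K n n := by
  rw [initialVarIdeal_self]
  exact F.minimal i v c

/-- Otherwise the basis vector `e_a`, a cycle modulo the variables by minimality, would be a
boundary modulo the variables. Boundaries have coordinates in that ideal too, so it would contain 1.
-/
theorem shift_le {s : ℤ}
    (hs : ∀ j, s < j → ∀ z, IsHomogeneousVec (F.shift 0) j z → F.aug z = 0) (i : ℕ)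
    (a : Fin (F.rank i)) : i ≤ n ∧ F.shift i a ≤ i + s := by
  by_contra h
  obtain ⟨v, w, -, hw, h⟩ := F.exists_eq_diff_add hs n le_rfl i (F.shift i a) (Pi.single a 1)
    (isHomogeneousVec_single _ _)
    (by
      cases i with
      | zero => trivial
      | succ i => exact F.diff_mem_initialVarIdeal i _)
    (by omega)
  have h1 : (1 : MvPolynomial (Fin n) K) ∈ initialVarIdeal K n n := by
    have := congrFun h a
    rw [Pi.single_eq_same] at this
    rw [this]
    exact add_mem (F.diff_mem_initialVarIdeal i _ a) (hw a)
  rw [mem_initialVarIdeal_self_iff] at h1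
  simp at h1

/-- `Tor_m(M, S/(x_0, …, x_{m-1}))` is nonzero in degree `m + s` if `s` is the top degree of `M`. -/
theorem exists_ne_diff_add {s : ℤ}
    (hs : ∀ j, s < j → ∀ z, IsHomogeneousVec (F.shift 0) j z → F.aug z = 0)
    (htop : ∃ z, IsHomogeneousVec (F.shift 0) s z ∧ F.aug z ≠ 0) (m : ℕ) :
    m ≤ n → ∃ z, IsHomogeneousVec (F.shift m) (m + s) z ∧
      F.IsCycleMod (initialVarIdeal K n m) m z ∧
      ∀ v w, (∀ c, w c ∈ initialVarIdeal K n m) → z ≠ F.diff m v + w := by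
  induction m with
  | zero =>
    intro _
    obtain ⟨z, hz, hne⟩ := htop
    refine ⟨z, by simpa using hz, trivial, ?_⟩
    rintro v w hw rfl
    have : w = 0 := funext fun c => by simpa [initialVarIdeal_zero] using hw c
    rw [this, add_zero] at hne
    exact hne ((F.exact_zero _).2 ⟨v, rfl⟩)
  | succ m ih =>
    intro hm
    have hm' : m < n := hm
    obtain ⟨z, hz, hc, hne⟩ := ih hm'.le
    have hXc : F.IsCycleMod (initialVarIdeal K n m) m
        ((X ⟨m, hm'⟩ : MvPolynomial (Fin n) K) • z) := by
      cases m with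
      | zero => trivial
      | succ m =>
        intro c
        rw [map_smul]
        exact Ideal.mul_mem_left _ _ (hc c)
    -- The degree of `x_m z` exceeds `m + s`, so its class vanishes. A bounding chain `w` is a cycle
    -- modulo the larger ideal, and the connecting homomorphism sends it to the class of `z`.
    obtain ⟨w, u, hw, hu, h⟩ := F.exists_eq_diff_add hs m hm'.le m _ _ (hz.X_smul ⟨m, hm'⟩) hXc
      (Or.inr (by omega))
    refine ⟨w, ?_, fun c => ?_, ?_⟩
    · convert hw using 1
      push_cast
      ring
    · rw [eq_sub_of_add_eq h.symm]
      exact sub_mem (Ideal.mul_mem_right _ _ (X_mem_initialVarIdeal (Nat.lt_succ_self m)))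
        (initialVarIdeal_le_succ m (hu c))
    · intro v w₁ hw₁ hvw
      choose u' hu' w' hw' using fun c => exists_of_mem_initialVarIdeal_succ hm' (hw₁ c)
      have hw₁' : w₁ = u' + (X ⟨m, hm'⟩ : MvPolynomial (Fin n) K) • w' := funext hw'
      -- If `w` were a boundary, cancelling `x_m` modulo the smaller ideal would make `z` the
      -- boundary of `w'`.
      refine hne w' (z - F.diff m w') (fun c => ?_) (by abel)
      apply mem_initialVarIdeal_of_X_mul_mem hm'
      rw [hvw, map_add, F.diff_diff, zero_add, hw₁', map_add, map_smul] at h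
      have h1 := congrFun h c
      simp only [Pi.add_apply, Pi.smul_apply, smul_eq_mul] at h1
      rw [Pi.sub_apply, mul_sub, h1]
      have : F.diff m u' c + X ⟨m, hm'⟩ * F.diff m w' c + u c - X ⟨m, hm'⟩ * F.diff m w' c =
        F.diff m u' c + u c := by ring
      rw [this]
      exact add_mem (map_mem_ideal _ hu' c) (hu c)

/-- The nonzero class in Tor_n has a coordinate with nonzero constant term; that coordinate is
homogeneous, hence of degree 0, which determines the shift. -/
theorem exists_shift_eq {s : ℤ}
    (hs : ∀ j, s < j → ∀ z, IsHomogeneousVec (F.shift 0) j z → F.aug z = 0)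
    (htop : ∃ z, IsHomogeneousVec (F.shift 0) s z ∧ F.aug z ≠ 0) :
    ∃ a : Fin (F.rank n), F.shift n a = n + s := by
  obtain ⟨z, hz, -, hne⟩ := F.exists_ne_diff_add hs htop n le_rfl
  have : ∃ a, z a ∉ initialVarIdeal K n n := by
    by_contra! h
    exact hne 0 z h (by simp)
  obtain ⟨a, ha⟩ := this
  rw [mem_initialVarIdeal_self_iff] at ha
  have := mem_polyPart_iff.1 (hz a) 0 ha
  rw [map_zero] at this
  exact ⟨a, by push_cast at this; omega⟩

theorem isGreatest_top {s : ℤ}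
    (hs : ∀ j, s < j → ∀ z, IsHomogeneousVec (F.shift 0) j z → F.aug z = 0)
    (htop : ∃ z, IsHomogeneousVec (F.shift 0) s z ∧ F.aug z ≠ 0) :
    IsGreatest {t : ℤ | ∃ (i : ℕ) (j : ℤ), F.betti i j ≠ 0 ∧ t = j - i} s := by
  constructor
  · obtain ⟨a, ha⟩ := F.exists_shift_eq hs htop
    refine ⟨n, n + s, ?_, by ring⟩
    exact Finset.card_ne_zero_of_mem (Finset.mem_filter.2 ⟨Finset.mem_univ a, ha⟩)
  · rintro t ⟨i, j, hij, rfl⟩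
    obtain ⟨a, ha⟩ := Finset.card_ne_zero.1 hij
    have h1 := (F.shift_le hs i a).2
    have h2 := (Finset.mem_filter.1 ha).2
    omega

end MinimalGradedFreeResolution

/-! ### Existence of minimal graded free resolutions -/

section Existence

variable {K : Type*} [Field K] {n : ℕ}

lemma exists_sum_vecComponent {r : ℕ} (σ : Fin r → ℤ) (v : Fin r → MvPolynomial (Fin n) K) :
    ∃ T : Finset ℤ, ∑ j ∈ T, vecComponent σ j v = v := by
  classical
  refine ⟨Finset.univ.biUnion fun c => (v c).support.image fun d => (d.degree : ℤ) + σ c, ?_⟩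
  ext c d
  rw [Finset.sum_apply, coeff_sum]
  simp only [vecComponent_apply, coeff_intComponent]
  by_cases hd : coeff d (v c) = 0
  · simp [hd]
  · simp only [eq_sub_iff_add_eq, Finset.sum_ite_eq]
    rw [if_pos]
    simp only [Finset.mem_biUnion, Finset.mem_univ, true_and, Finset.mem_image, mem_support_iff]
    exact ⟨c, d, hd, rfl⟩

/-- A graded submodule of a graded free module of finite rank is generated by finitely many
homogeneous elements. -/
lemma exists_homogeneous_generators {r : ℕ} (σ : Fin r → ℤ)
    (N : Submodule (MvPolynomial (Fin n) K) (Fin r → MvPolynomial (Fin n) K))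
    (hN : ∀ j, ∀ v ∈ N, vecComponent σ j v ∈ N) :
    ∃ (t : ℕ) (e : Fin t → ℤ) (g : Fin t → Fin r → MvPolynomial (Fin n) K),
      (∀ a, IsHomogeneousVec σ (e a) (g a)) ∧
      Submodule.span (MvPolynomial (Fin n) K) (Set.range g) = N := by
  have hspan : Submodule.span (MvPolynomial (Fin n) K)
      {v | v ∈ N ∧ ∃ j, IsHomogeneousVec σ j v} = N := by
    refine le_antisymm (Submodule.span_le.2 fun v hv => hv.1) fun v hv => ?_
    obtain ⟨T, hT⟩ := exists_sum_vecComponent σ v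
    rw [← hT]
    exact sum_mem fun j _ => Submodule.subset_span
      ⟨hN j v hv, j, isHomogeneousVec_vecComponent _ _ _⟩
  obtain ⟨s', hs', hs⟩ := (Submodule.fg_span_iff_fg_span_finset_subset _).1
    (IsNoetherian.noetherian (Submodule.span (MvPolynomial (Fin n) K)
      {v | v ∈ N ∧ ∃ j, IsHomogeneousVec σ j v}))
  rw [hspan] at hs
  choose e he using fun a : Fin s'.card => (hs' (s'.equivFin.symm a).2).2
  refine ⟨s'.card, e, fun a => s'.equivFin.symm a, he, ?_⟩
  rw [hs]
  congr 1
  ext v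
  constructor
  · rintro ⟨a, rfl⟩
    exact (s'.equivFin.symm a).2
  · intro hv
    exact ⟨s'.equivFin ⟨v, hv⟩, by simp⟩

/-- The first step of a minimal graded free resolution of a graded submodule `N` of a graded free
module of finite rank. -/
lemma exists_minimal_cover {r : ℕ} (σ : Fin r → ℤ)
    (N : Submodule (MvPolynomial (Fin n) K) (Fin r → MvPolynomial (Fin n) K))
    (hN : ∀ j, ∀ v ∈ N, vecComponent σ j v ∈ N) :
    ∃ (t : ℕ) (e : Fin t → ℤ) (φ : (Fin t → MvPolynomial (Fin n) K)
        →ₗ[MvPolynomial (Fin n) K] (Fin r → MvPolynomial (Fin n) K)),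
      (∀ a c, φ (Pi.single a 1) c ∈ polyPart K n (e a - σ c)) ∧
      LinearMap.range φ = N ∧ ∀ v ∈ LinearMap.ker φ, ∀ c, v c ∈ initialVarIdeal K n n := by
  classical
  -- Minimality comes from choosing the least possible number of homogeneous generators.
  have hex := exists_homogeneous_generators σ N hN
  obtain ⟨e, g, hg, hspan⟩ := Nat.find_spec hex
  have hmin := fun m => Nat.find_min (m := m) hex
  revert hmin e g
  generalize Nat.find hex = t
  intro e g hg hspan hmin
  have hφ : ∀ a, Fintype.linearCombination (MvPolynomial (Fin n) K) g (Pi.single a 1) = g a := by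
    intro a
    simp [Fintype.linearCombination_apply_single]
  have hgr : ∀ a c, Fintype.linearCombination (MvPolynomial (Fin n) K) g (Pi.single a 1) c ∈
      polyPart K n (e a - σ c) := by
    intro a c
    rw [hφ]
    exact hg a c
  refine ⟨t, e, Fintype.linearCombination (MvPolynomial (Fin n) K) g, hgr, ?_, ?_⟩
  · rw [Fintype.range_linearCombination, hspan]
  intro v hv b
  by_contra hvb
  rw [mem_initialVarIdeal_self_iff] at hvb
  -- In degree `e b` the relation has a nonzero constant as coefficient of `g b`, so `g b` is
  -- redundant and can be deleted.
  set w := vecComponent e (e b) v with hw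
  have hw0 : Fintype.linearCombination (MvPolynomial (Fin n) K) g w = 0 := by
    rw [hw, map_vecComponent (σ := σ) hgr, LinearMap.mem_ker.1 hv, map_zero]
  have hwb : w b = C (coeff 0 (v b)) := by
    ext d
    rw [hw, vecComponent_apply, coeff_intComponent, coeff_C]
    by_cases hd : d = 0
    · subst hd
      simp
    · rw [if_neg (by simpa [Finsupp.degree_eq_zero_iff] using hd), if_neg (Ne.symm hd)]
  cases t with
  | zero => exact b.elim0
  | succ t =>
    refine hmin t (Nat.lt_succ_self t) ⟨fun a => e (b.succAbove a), fun a => g (b.succAbove a),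
      fun a => hg _, le_antisymm ?_ ?_⟩
    · rw [← hspan]
      exact Submodule.span_mono (by rintro _ ⟨a, rfl⟩; exact ⟨_, rfl⟩)
    · rw [← hspan, Submodule.span_le]
      rintro _ ⟨a, rfl⟩
      rcases Fin.eq_self_or_eq_succAbove b a with rfl | ⟨a, rfl⟩
      · rw [Fintype.linearCombination_apply, Fin.sum_univ_succAbove _ a, hwb] at hw0
        have h1 : g a = (C (coeff 0 (v a))⁻¹ : MvPolynomial (Fin n) K) •
            ((C (coeff 0 (v a)) : MvPolynomial (Fin n) K) • g a) := by
          rw [smul_smul, ← C_mul, inv_mul_cancel₀ hvb, C_1, one_smul]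
        rw [h1, eq_neg_of_add_eq_zero_left hw0]
        exact Submodule.smul_mem _ _ (neg_mem (sum_mem fun i _ =>
          Submodule.smul_mem _ _ (Submodule.subset_span ⟨i, rfl⟩)))
      · exact Submodule.subset_span ⟨a, rfl⟩

/-- A graded free module of finite rank with a graded submodule contained in `(x_1, …, x_n) F`. -/
structure SyzygyStage (K : Type*) [Field K] (n : ℕ) where
  /-- the rank of the free module -/
  rank : ℕ
  /-- the degrees of the basis elements -/
  shift : Fin rank → ℤ
  /-- the submodule -/
  syz : Submodule (MvPolynomial (Fin n) K) (Fin rank → MvPolynomial (Fin n) K)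
  vecComponent_mem : ∀ j, ∀ v ∈ syz, vecComponent shift j v ∈ syz
  mem_ideal : ∀ v ∈ syz, ∀ c, v c ∈ initialVarIdeal K n n

/-- The kernel of a minimal cover is graded and lies in the ideal of the variables, so it serves as
the next syzygy module. -/
lemma SyzygyStage.exists_next (A : SyzygyStage K n) :
    ∃ (B : SyzygyStage K n) (φ : (Fin B.rank → MvPolynomial (Fin n) K)
        →ₗ[MvPolynomial (Fin n) K] (Fin A.rank → MvPolynomial (Fin n) K)),
      (∀ a c, φ (Pi.single a 1) c ∈ polyPart K n (B.shift a - A.shift c)) ∧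
      LinearMap.range φ = A.syz ∧ LinearMap.ker φ = B.syz := by
  obtain ⟨t, e, φ, hφ, hr, hk⟩ := exists_minimal_cover A.shift A.syz A.vecComponent_mem
  refine ⟨⟨t, e, LinearMap.ker φ, fun j v hv => ?_, hk⟩, φ, hφ, hr, rfl⟩
  rw [LinearMap.mem_ker, map_vecComponent hφ, LinearMap.mem_ker.1 hv, map_zero]

/-- The stages of a minimal graded free resolution. -/
noncomputable def SyzygyStage.iterate (A : SyzygyStage K n) : ℕ → SyzygyStage K n
  | 0 => A
  | i + 1 => (A.iterate i).exists_next.choose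

theorem nonempty_minimalGradedFreeResolution {M : Type*} [AddCommGroup M] [Module K M]
    [Module (MvPolynomial (Fin n) K) M] (𝓜 : ℤ → Submodule K M) (A : SyzygyStage K n)
    (aug : (Fin A.rank → MvPolynomial (Fin n) K) →ₗ[MvPolynomial (Fin n) K] M)
    (haug : ∀ a, aug (Pi.single a 1) ∈ 𝓜 (A.shift a)) (hsurj : Function.Surjective aug)
    (hker : LinearMap.ker aug = A.syz) :
    Nonempty (MinimalGradedFreeResolution (n := n) 𝓜) := by
  have hstep : ∀ i, ∃ φ : (Fin (A.iterate (i + 1)).rank → MvPolynomial (Fin n) K)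
      →ₗ[MvPolynomial (Fin n) K] (Fin (A.iterate i).rank → MvPolynomial (Fin n) K),
      (∀ a c, φ (Pi.single a 1) c ∈
        polyPart K n ((A.iterate (i + 1)).shift a - (A.iterate i).shift c)) ∧
      LinearMap.range φ = (A.iterate i).syz ∧ LinearMap.ker φ = (A.iterate (i + 1)).syz :=
    fun i => (A.iterate i).exists_next.choose_spec
  choose φ hφ hr hk using hstep
  have h0 : Function.Exact (φ 0) aug := LinearMap.exact_iff.2 (hker.trans (hr 0).symm)
  have hs : ∀ i, Function.Exact (φ (i + 1)) (φ i) := fun i =>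
    LinearMap.exact_iff.2 ((hk i).trans (hr (i + 1)).symm)
  exact ⟨{
    rank := fun i => (A.iterate i).rank
    shift := fun i => (A.iterate i).shift
    diff := φ
    aug := aug
    diff_graded := hφ
    aug_graded := haug
    aug_surjective := hsurj
    exact_zero := h0
    exact_succ := hs
    minimal := fun i v c => by
      rw [← initialVarIdeal_self]
      exact (A.iterate i).mem_ideal _ (hr i ▸ LinearMap.mem_range_self (φ i) v) c }⟩

end Existence

/-! ### The Hilbert depth of a finitely supported function -/

/-- After exchanging the sums, the coefficient of `h j` is the alternating sum of row `d - j` of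
Pascal's triangle, which vanishes unless `j = d`. -/
lemma sum_hilbertBeta (h : ℤ → ℕ) {d : ℤ} (hd : initialDegree h ≤ d) :
    ∑ k ∈ Finset.Icc (initialDegree h) d, hilbertBeta h d k = h d := by
  have hinner : ∀ j ∈ Finset.Icc (initialDegree h) d, ∑ k ∈ Finset.Icc j d,
      (-1 : ℤ) ^ (k - j).toNat * ((d - j).toNat.choose (k - j).toNat : ℤ) * (h j : ℤ) =
      if j = d then (h j : ℤ) else 0 := by
    intro j hj
    rw [Finset.mem_Icc] at hj
    rw [← Finset.sum_mul]
    have : ∑ k ∈ Finset.Icc j d, (-1 : ℤ) ^ (k - j).toNat *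
        ((d - j).toNat.choose (k - j).toNat : ℤ) =
        ∑ m ∈ Finset.range ((d - j).toNat + 1), (-1 : ℤ) ^ m * ((d - j).toNat.choose m : ℤ) := by
      refine Finset.sum_nbij' (fun k => (k - j).toNat) (fun m => j + m) ?_ ?_ ?_ ?_ ?_
      · intro k hk
        simp only [Finset.mem_Icc, Finset.mem_range] at *
        omega
      · intro m hm
        simp only [Finset.mem_Icc, Finset.mem_range] at *
        omega
      · intro k hk
        simp only [Finset.mem_Icc] at *
        omega
      · intro m hm
        simp
      · intros
        rfl
    rw [this, Int.alternating_sum_range_choose]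
    split_ifs <;> omega
  calc ∑ k ∈ Finset.Icc (initialDegree h) d, hilbertBeta h d k
      = ∑ k ∈ Finset.Icc (initialDegree h) d, ∑ j ∈ Finset.Icc (initialDegree h) k,
        (-1 : ℤ) ^ (k - j).toNat * ((d - j).toNat.choose (k - j).toNat : ℤ) * (h j : ℤ) :=
        Finset.sum_congr rfl fun k hk => if_pos (Finset.mem_Icc.1 hk)
    _ = ∑ j ∈ Finset.Icc (initialDegree h) d, ∑ k ∈ Finset.Icc j d,
        (-1 : ℤ) ^ (k - j).toNat * ((d - j).toNat.choose (k - j).toNat : ℤ) * (h j : ℤ) :=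
        Finset.sum_comm' fun k j => by
          simp only [Finset.mem_Icc]
          omega
    _ = ∑ j ∈ Finset.Icc (initialDegree h) d, if j = d then (h j : ℤ) else 0 :=
        Finset.sum_congr rfl hinner
    _ = h d := by
        rw [Finset.sum_ite_eq', if_pos (Finset.mem_Icc.2 ⟨hd, le_rfl⟩)]

lemma hilbertBeta_initialDegree (h : ℤ → ℕ) {d : ℤ} (hd : initialDegree h ≤ d) :
    hilbertBeta h d (initialDegree h) = h (initialDegree h) := by
  rw [hilbertBeta, if_pos ⟨le_rfl, hd⟩]
  simp

/-- The Hilbert depth exists and is at most the last degree in which `h` does not vanish. -/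
theorem exists_isHilbertDepth_le {h : ℤ → ℕ} {b s : ℤ} (hb : ∀ j, h j ≠ 0 → b ≤ j)
    (hs : ∀ j, h j ≠ 0 → j ≤ s) (hne : h s ≠ 0) : ∃ q, IsHilbertDepth h q ∧ q ≤ s := by
  have hbdd : BddBelow {j : ℤ | h j ≠ 0} := ⟨b, hb⟩
  -- The infimum is attained because the set is nonempty and bounded below; otherwise `sInf` would
  -- be a default value.
  have h0 : h (initialDegree h) ≠ 0 := Int.csInf_mem ⟨s, hne⟩ hbdd
  have hle : ∀ d ∈ {d : ℤ | ∀ k : ℤ, k ≤ d → 0 ≤ hilbertBeta h d k}, d ≤ s := by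
    intro d hd
    by_contra! hsd
    have hkd : initialDegree h ≤ d := (hs _ h0).trans hsd.le
    have hd0 : h d = 0 := by
      by_contra hd0
      exact absurd (hs d hd0) (not_le.2 hsd)
    have hsum := sum_hilbertBeta h hkd
    rw [hd0, Nat.cast_zero, Finset.sum_eq_zero_iff_of_nonneg
      fun k hk => hd k (Finset.mem_Icc.1 hk).2] at hsum
    have := hsum _ (Finset.mem_Icc.2 ⟨le_rfl, hkd⟩)
    rw [hilbertBeta_initialDegree h hkd] at this
    exact h0 (by exact_mod_cast this)
  -- Below the initial degree every β is zero, so some `d` is admissible and the maximum exists.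
  have hmem : initialDegree h - 1 ∈ {d : ℤ | ∀ k : ℤ, k ≤ d → 0 ≤ hilbertBeta h d k} := by
    intro k hk
    rw [hilbertBeta, if_neg (by omega)]
  obtain ⟨q, hq, hq'⟩ := Int.exists_greatest_of_bdd ⟨s, hle⟩ ⟨_, hmem⟩
  exact ⟨q, ⟨hq, hq'⟩, hle q hq⟩

/-! ### Graded quotients of the polynomial ring -/

section Quotient

variable {K : Type*} [Field K] {n : ℕ} {I : Ideal (MvPolynomial (Fin n) K)}

lemma mem_quotientPart {k : ℤ} {m : MvPolynomial (Fin n) K ⧸ I} :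
    m ∈ quotientPart I k ↔ ∃ f ∈ polyPart K n k, Ideal.Quotient.mk I f = m := Iff.rfl

lemma quotientPart_eq_bot_iff {k : ℤ} : quotientPart I k = ⊥ ↔ ∀ f ∈ polyPart K n k, f ∈ I := by
  rw [eq_bot_iff]
  constructor
  · intro h f hf
    exact Ideal.Quotient.eq_zero_iff_mem.1 (h (mem_quotientPart.2 ⟨f, hf, rfl⟩))
  · rintro h _ ⟨f, hf, rfl⟩
    exact Ideal.Quotient.eq_zero_iff_mem.2 (h f hf)

lemma quotientPart_of_neg {k : ℤ} (hk : k < 0) : quotientPart I k = ⊥ := by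
  rw [quotientPart, polyPart, if_neg (not_le.2 hk), Submodule.map_bot]

/-- A proper homogeneous ideal is contained in the ideal of the variables. -/
lemma mem_initialVarIdeal_of_mem (hI : I.IsHomogeneous (homogeneousSubmodule (Fin n) K))
    (hne : I ≠ ⊤) {f : MvPolynomial (Fin n) K} (hf : f ∈ I) : f ∈ initialVarIdeal K n n := by
  rw [mem_initialVarIdeal_self_iff]
  by_contra h
  have h0 := homogeneousComponent_mem_of_mem hI hf 0
  rw [homogeneousComponent_zero] at h0
  exact hne (I.eq_top_of_isUnit_mem h0 ((isUnit_iff_ne_zero.2 h).map C))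

/-- An Artinian graded quotient of the polynomial ring vanishes in large degrees. -/
lemma exists_quotientPart_eq_bot (hI : I.IsHomogeneous (homogeneousSubmodule (Fin n) K))
    (hA : IsArtinianRing (MvPolynomial (Fin n) K ⧸ I)) :
    ∃ N : ℕ, ∀ k : ℤ, N ≤ k → quotientPart I k = ⊥ := by
  -- The images of the powers of the ideal of the variables form a descending chain, hence
  -- stabilize.
  obtain ⟨N, hN⟩ := IsArtinian.monotone_stabilizes
    (⟨fun k => OrderDual.toDual ((idealOfVars (Fin n) K ^ k).map (Ideal.Quotient.mk I)),
      fun a b hab => Ideal.map_mono (Ideal.pow_le_pow_right hab)⟩ :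
      ℕ →o (Ideal (MvPolynomial (Fin n) K ⧸ I))ᵒᵈ)
  refine ⟨N, fun k hk => quotientPart_eq_bot_iff.2 fun f hf => ?_⟩
  lift k to ℕ using by omega
  have heq : (idealOfVars (Fin n) K ^ k).map (Ideal.Quotient.mk I) =
      (idealOfVars (Fin n) K ^ (k + 1)).map (Ideal.Quotient.mk I) :=
    (hN k (by omega)).symm.trans (hN (k + 1) (by omega))
  have hfk : f ∈ idealOfVars (Fin n) K ^ k := by
    rw [mem_pow_idealOfVars_iff]
    intro d hd
    have := mem_polyPart_iff.1 hf d (mem_support_iff.1 hd)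
    omega
  have := Ideal.mem_map_of_mem (Ideal.Quotient.mk I) hfk
  rw [heq, Ideal.mem_map_iff_of_surjective _ Ideal.Quotient.mk_surjective] at this
  obtain ⟨g, hg, hgf⟩ := this
  -- Modulo `I`, `f` equals some `g` of order at least `k + 1`. The degree `k` component of `g - f`
  -- is `-f`, and it lies in `I`.
  have hmem := intComponent_mem_of_isHomogeneous hI k (Ideal.Quotient.eq.1 hgf)
  rw [map_sub, intComponent_of_mem hf] at hmem
  have hg0 : intComponent K n k g = 0 := by
    ext d
    rw [coeff_intComponent, coeff_zero]
    split_ifs with h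
    · by_contra hd
      rw [mem_pow_idealOfVars_iff] at hg
      have := hg d (mem_support_iff.2 hd)
      omega
    · rfl
  rw [hg0, zero_sub] at hmem
  exact neg_mem_iff.1 hmem

namespace MinimalGradedFreeResolution

variable (F : MinimalGradedFreeResolution (n := n) (quotientPart I))

lemma aug_mem_quotientPart {j : ℤ} {z : Fin (F.rank 0) → MvPolynomial (Fin n) K}
    (hz : IsHomogeneousVec (F.shift 0) j z) : F.aug z ∈ quotientPart I j := by
  rw [linearMap_pi_apply_eq_sum]
  refine sum_mem fun a _ => ?_
  obtain ⟨g, hg, hga⟩ := mem_quotientPart.1 (F.aug_graded a)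
  rw [← hga]
  refine mem_quotientPart.2 ⟨z a * g, ?_, rfl⟩
  simpa using mul_mem_polyPart (hz a) hg

/-- Lifting the augmentation to polynomials reduces this to the homogeneity of `I`. It yields a
homogeneous preimage of a top-degree element. -/
lemma aug_vecComponent_of_mem (hI : I.IsHomogeneous (homogeneousSubmodule (Fin n) K)) {j : ℤ}
    {v : Fin (F.rank 0) → MvPolynomial (Fin n) K} (hv : F.aug v ∈ quotientPart I j) :
    F.aug (vecComponent (F.shift 0) j v) = F.aug v := by
  choose g hg hga using fun a => mem_quotientPart.1 (F.aug_graded a)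
  have haug : ∀ w, F.aug w = Ideal.Quotient.mk I (∑ a, w a * g a) := by
    intro w
    rw [linearMap_pi_apply_eq_sum, map_sum]
    refine Finset.sum_congr rfl fun a _ => ?_
    rw [← hga]
    rfl
  obtain ⟨f, hf, hfv⟩ := mem_quotientPart.1 hv
  rw [← hfv, haug, Ideal.Quotient.eq]
  rw [haug, Eq.comm, Ideal.Quotient.eq] at hfv
  have := intComponent_mem_of_isHomogeneous hI j hfv
  rw [map_sub, intComponent_of_mem hf, map_sum] at this
  simpa only [intComponent_mul (hg _), vecComponent_apply] using this

end MinimalGradedFreeResolution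

end Quotient

/-! ### Regularity as top degree, and the comparison with the Hilbert depth -/

section Regularity

variable {K : Type*} [Field K] {n : ℕ} {I : Ideal (MvPolynomial (Fin n) K)}

/-- The resolution starts with `S → S/I`; it is minimal there because a proper homogeneous ideal
contains no polynomial with a constant term. -/
theorem nonempty_resolution_quotient (hI : I.IsHomogeneous (homogeneousSubmodule (Fin n) K))
    (hne : I ≠ ⊤) : Nonempty (MinimalGradedFreeResolution (n := n) (quotientPart I)) := by
  let aug : (Fin 1 → MvPolynomial (Fin n) K) →ₗ[MvPolynomial (Fin n) K]
      (MvPolynomial (Fin n) K ⧸ I) := I.mkQ.comp (LinearMap.proj 0)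
  have hker : ∀ v, v ∈ LinearMap.ker aug ↔ v 0 ∈ I := fun v => by
    rw [LinearMap.mem_ker]
    exact Ideal.Quotient.eq_zero_iff_mem
  let A : SyzygyStage K n :=
    { rank := 1
      shift := 0
      syz := LinearMap.ker aug
      vecComponent_mem := fun j v hv => by
        rw [hker] at hv ⊢
        exact intComponent_mem_of_isHomogeneous hI _ hv
      mem_ideal := fun v hv c => by
        rw [hker] at hv
        rw [Subsingleton.elim c 0]
        exact mem_initialVarIdeal_of_mem hI hne hv }
  refine nonempty_minimalGradedFreeResolution (quotientPart I) A aug (fun a => ?_) ?_ rfl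
  · refine mem_quotientPart.2 ⟨1, one_mem_polyPart, ?_⟩
    have ha : a = (0 : Fin 1) := Subsingleton.elim (α := Fin 1) a 0
    subst ha
    change _ = Ideal.Quotient.mk I ((Pi.single 0 1 : Fin 1 → MvPolynomial (Fin n) K) 0)
    rw [Pi.single_eq_same]
  · intro m
    obtain ⟨f, rfl⟩ := Ideal.Quotient.mk_surjective m
    exact ⟨fun _ => f, rfl⟩

/-- The Castelnuovo-Mumford regularity of a graded quotient which vanishes in large degrees is
its top degree. -/
theorem isRegularity_quotientPart (hI : I.IsHomogeneous (homogeneousSubmodule (Fin n) K))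
    (hne : I ≠ ⊤) {s : ℤ} (hs : ∀ j, s < j → quotientPart I j = ⊥)
    (htop : quotientPart I s ≠ ⊥) : IsRegularity n (quotientPart I) s := by
  refine ⟨nonempty_resolution_quotient hI hne, fun F => F.isGreatest_top (fun j hj z hz => ?_) ?_⟩
  · have := F.aug_mem_quotientPart hz
    rwa [hs j hj, Submodule.mem_bot] at this
  · obtain ⟨m, hm, hm0⟩ := Submodule.exists_mem_ne_zero_of_ne_bot htop
    obtain ⟨v, rfl⟩ := F.aug_surjective m
    exact ⟨vecComponent (F.shift 0) s v, isHomogeneousVec_vecComponent _ _ _, by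
      rwa [F.aug_vecComponent_of_mem hI hm]⟩

end Regularity

theorem corollary1p5 {K : Type*} [Field K] (n : ℕ) (I : Ideal (MvPolynomial (Fin n) K))
    (hI : I.IsHomogeneous (homogeneousSubmodule (Fin n) K)) (hne : I ≠ ⊤)
    (hA : IsArtinianRing (MvPolynomial (Fin n) K ⧸ I)) :
    ∃ q r : ℤ, IsHilbertDepth (hilbertFunction (quotientPart I)) q ∧
      IsRegularity n (quotientPart I) r ∧ q ≤ r := by
  -- Finite dimension ensures that `finrank` is zero only on zero components, so `hilbertFunction`
  -- detects the top degree.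
  have hfin : Module.Finite K (MvPolynomial (Fin n) K ⧸ I) := Module.finite_of_isArtinianRing K _
  have hh : ∀ j, hilbertFunction (quotientPart I) j ≠ 0 ↔ quotientPart I j ≠ ⊥ := fun j => by
    rw [hilbertFunction, Ne, Submodule.finrank_eq_zero]
  have h0 : quotientPart I 0 ≠ ⊥ := fun h =>
    hne ((Ideal.eq_top_iff_one I).2 (quotientPart_eq_bot_iff.1 h 1 one_mem_polyPart))
  obtain ⟨N, hN⟩ := exists_quotientPart_eq_bot hI hA
  obtain ⟨s, hs, hmax⟩ := Int.exists_greatest_of_bdd (P := fun j => quotientPart I j ≠ ⊥)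
    ⟨N, fun j hj => by
      by_contra! h
      exact hj (hN j h.le)⟩ ⟨0, h0⟩
  obtain ⟨q, hq, hqs⟩ := exists_isHilbertDepth_le (h := hilbertFunction (quotientPart I))
    (b := 0) (s := s)
    (fun j hj => by
      by_contra! h
      exact (hh j).1 hj (quotientPart_of_neg h))
    (fun j hj => hmax j ((hh j).1 hj)) ((hh s).2 hs)
  refine ⟨q, s, hq, isRegularity_quotientPart hI hne (fun j hj => ?_) hs, hqs⟩
  by_contra h
  exact absurd (hmax j h) (not_le.2 hj)
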